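/- **Setting.** Let $n\ge 2$, let $\Omega\subset\mathbb R^{n+1}$ be a 1-sided chord arc domain (a connected open set satisfying the interior corkscrew and Harnack chain conditions, whose boundary is $n$-dimensional Ahlfors–David regular), and put $\delta(Y)=\operatorname{dist}(Y,\partial\Omega)$, $\sigma=\mathcal H^n|_{\partial\Omega}$. *Dyadic cubes.* Let $(\mathbb D_k)_{k\in\mathbb Z}$ be a dyadic grid on $\partial\Omega$ with constants $a_0,s,C_1>0$: each $\mathbb D_k$ is a family of Borel subsets of $\partial\Omega$ covering $\partial\Omega$; if $m\ge k$, $Q\in\mathbb D_m$, $Q'\in\mathbb D_k$, then $Q\subset Q'$ or $Q\cap Q'=\emptyset$; for $m<k$ each $Q\in\mathbb D_k$ lies in a unique $Q'\in\mathbb D_m$; each $Q\in\mathbb D_k$ has diameter at most $C_12^{-k}$, contains a surface ball $B(x,a_02^{-k})\cap\partial\Omega$ with $x\in\partial\Omega$, and satisfies $\mathcal H^n(\{x\in Q:\operatorname{dist}(x,\partial\Omega\setminus Q)\le\vartheta 2^{-k}\})\le C_1\vartheta^s\mathcal H^n(Q)$ for $0<\vartheta<a_0$. Let $\mathbb D=\mathbb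 D(\partial\Omega)$ be the collection of all cubes $Q\in\mathbb D_k$ with $2^{-k}\lesssim\operatorname{diam}(\partial\Omega)$, where a cube is regarded as carrying its generation $k$, and $\ell(Q)=2^{-k}$. (A sub-cube of $Q$ is a cube of the same or a later generation contained in $Q$.) A *tree* with top cube $Q_0\in\mathbb D$ is a collection $\mathbf S\subset\mathbb D$ of sub-cubes of $Q_0$, with $Q_0\in\mathbf S$, such that if $Q\in\mathbf S$, $Q'\in\mathbb D$, $Q$ is a sub-cube of $Q'$ and $Q'$ is a sub-cube of $Q_0$, then $Q'\in\mathbf S$. *Whitney regions.* Let $\mathcal W$ be a decomposition of $\Omega$ into non-overlapping closed dyadic Whitney cubes with $4\operatorname{diam}(I)\le\operatorname{dist}(4I,\partial\Omega)\le\operatorname{dist}(I,\partial\Omega)\le 40\operatorname{diam}(I)$, the diameters of touching cubes being within a factor $4$ of each other. Fix $\tau\in(0,1]$ and set $I^*=(1+\tau)I$ (concentric dilate). The Whitney region of $Q\in\mathbb D$ is $U_Q=\bigcup_{I\in\mathcal W(Q)}I^*$, where $\mathcal W(Q)\subset\mathcal W$ is nonempty and $$\ell(Q)\approx\ell(I)\approx\operatorname{dist}(Q,I)\approx\operatorname{dist}(Q,I^*)\approx\operatorname{dist}(\partial\Omega,I^*)\qquad\text{for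 all } I\in\mathcal W(Q).$$ For $M\ge2$ let $\mathbb D^M(Q)$ be the set of $Q'\in\mathbb D$ with $\frac1M\le\frac{\ell(Q')}{\ell(Q)}\le M$ and $\operatorname{dist}(Q,Q')\le M\operatorname{diam}(Q)$, and put $U_Q^M=\bigcup_{Q'\in\mathbb D^M(Q)}U_{Q'}$. For a tree $\mathbf S$ let $\Omega_{\mathbf S}=\operatorname{int}\big(\bigcup_{Q\in\mathbf S}U_Q\big)$ be the sawtooth domain, and $\delta_\star(Y)=\operatorname{dist}(Y,\partial\Omega_{\mathbf S})$. *Square functions.* For a measurable vector field $\mathbf B:\Omega\to\mathbb R^{n+1}$ put $$\mathcal A^M_{\mathbf S}(\mathbf B)(x)=\Big(\sum_{Q\in\mathbf S}1_Q(x)\iint_{U_Q^M}|\mathbf B(Y)|^2\,\delta(Y)^{1-n}\,dY\Big)^{1/2},\qquad x\in\partial\Omega,$$ $$\mathcal A_\star(\mathbf B)(z)=\Big(\iint_{\{Y\in\Omega_{\mathbf S}:\,|z-Y|<10\delta_\star(Y)\}}|\mathbf B(Y)|^2\,\delta_\star(Y)^{1-n}\,dY\Big)^{1/2},\qquad z\in\partial\Omega_{\mathbf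 S}.$$ **Lemma.** There are constants $M_0\ge2$ and $C>0$, depending only on $n$, the 1-sided chord arc constants of $\Omega$, the constants of the dyadic grid (including the one in $2^{-k}\lesssim\operatorname{diam}(\partial\Omega)$) and the implicit constant in the comparabilities that define the Whitney regions, such that for every $M\ge M_0$, every $Q_0\in\mathbb D(\partial\Omega)$, every tree $\mathbf S$ with top cube $Q_0$, and every measurable $\mathbf B$, $$\operatorname*{ess\,sup}_{z\in\partial\Omega_{\mathbf S}}\mathcal A_\star(\mathbf B)(z)\ \le\ C\Big(\|\mathcal A^M_{\mathbf S}(\mathbf B)\|_{L^\infty(Q_0,\sigma)}+\operatorname*{ess\,sup}_{Y\in\Omega_{\mathbf S}}\delta(Y)|\mathbf B(Y)|\Big),$$ where the essential supremum on the left is with respect to $\mathcal H^n|_{\partial\Omega_{\mathbf S}}$, the last one is with respect to Lebesgue measure, and both sides may be $+\infty$. -/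

import Mathlib

open MeasureTheory Set
open scoped ENNReal

noncomputable section

namespace Sawtooth

/-- Points of the ambient space `ℝ^{n+1}`, with the Euclidean norm. -/
abbrev Pt (n : ℕ) : Type := EuclideanSpace ℝ (Fin (n + 1))

/-- `dist(A, F) = inf {|a - b| : a ∈ A, b ∈ F}` (used for nonempty sets). -/
def setDist {n : ℕ} (A F : Set (Pt n)) : ℝ :=
  sInf {r : ℝ | ∃ a ∈ A, ∃ b ∈ F, r = dist a b}

/-- `n`-dimensional Hausdorff measure on `ℝ^{n+1}`. -/
def hausN (n : ℕ) : Measure (Pt n) := Measure.hausdorffMeasure (n : ℝ)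

/-- Surface measure `σ` on `∂Ω`. -/
def surf {n : ℕ} (Ω : Set (Pt n)) : Measure (Pt n) := (hausN n).restrict (frontier Ω)

/-- The distance from `X` to the boundary of `Ω`. -/
def bdist {n : ℕ} (Ω : Set (Pt n)) (X : Pt n) : ℝ := Metric.infDist X (frontier Ω)

/-! ### One-sided chord arc domains -/

/-- The closed set `E` is `n`-dimensional Ahlfors-David regular with constant `C`;
`diam E` may be infinite. -/
def IsADR {n : ℕ} (E : Set (Pt n)) (C : ℝ) : Prop :=
  IsClosed E ∧ ∀ x ∈ E, ∀ r : ℝ, 0 < r → ENNReal.ofReal r < Metric.ediam E →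
    ENNReal.ofReal (C⁻¹ * r ^ n) ≤ hausN n (E ∩ Metric.ball x r) ∧
      hausN n (E ∩ Metric.ball x r) ≤ ENNReal.ofReal (C * r ^ n)

/-- The corkscrew condition with constant `c`. -/
def IsCorkscrew {n : ℕ} (Ω : Set (Pt n)) (c : ℝ) : Prop :=
  ∀ x ∈ frontier Ω, ∀ r : ℝ, 0 < r → ENNReal.ofReal r < Metric.ediam (frontier Ω) →
    ∃ X : Pt n, Metric.ball X (c * r) ⊆ Metric.ball x r ∩ Ω

/-- The Harnack chain condition: two points `X, X'` of `Ω` at distance at least `ρ` from the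
boundary, with `|X - X'| < K ρ`, are joined by a chain of at most `N K` balls
`ball (x 0) (r 0), …, ball (x m) (r m)` whose diameters are comparable (with constants `c`, `C`)
to their distances to the boundary. -/
def IsHarnackChain {n : ℕ} (Ω : Set (Pt n)) (c C : ℝ) (N : ℝ → ℕ) : Prop :=
  ∀ ρ K : ℝ, 0 < ρ → 1 ≤ K → ∀ X ∈ Ω, ∀ X' ∈ Ω,
    ρ ≤ bdist Ω X → ρ ≤ bdist Ω X' → dist X X' < K * ρ →
    ∃ (m : ℕ) (x : ℕ → Pt n) (r : ℕ → ℝ), m + 1 ≤ N K ∧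
      X ∈ Metric.ball (x 0) (r 0) ∧ X' ∈ Metric.ball (x m) (r m) ∧
      (∀ i < m, (Metric.ball (x i) (r i) ∩ Metric.ball (x (i + 1)) (r (i + 1))).Nonempty) ∧
      ∀ i ≤ m, Metric.ball (x i) (r i) ⊆ Ω ∧
        c * Metric.diam (Metric.ball (x i) (r i))
          ≤ setDist (Metric.ball (x i) (r i)) (frontier Ω) ∧
        setDist (Metric.ball (x i) (r i)) (frontier Ω)
          ≤ C * Metric.diam (Metric.ball (x i) (r i))

/-- The quantitative constants of a 1-sided chord arc domain. -/
structure CADConst where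
  /-- Ahlfors-David constant of the boundary -/
  adr : ℝ
  /-- corkscrew constant -/
  cork : ℝ
  /-- lower constant for the balls in Harnack chains -/
  hcLow : ℝ
  /-- upper constant for the balls in Harnack chains -/
  hcUp : ℝ
  /-- bound for the length of Harnack chains -/
  hcLen : ℝ → ℕ
  adr_ge : 1 ≤ adr
  cork_pos : 0 < cork
  hcLow_pos : 0 < hcLow
  hcUp_pos : 0 < hcUp

/-- `Ω` is a 1-sided chord arc domain with constants `c`. -/
structure IsOneSidedCAD {n : ℕ} (c : CADConst) (Ω : Set (Pt n)) : Prop where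
  isOpen : IsOpen Ω
  connected : IsConnected Ω
  corkscrew : IsCorkscrew Ω c.cork
  harnack : IsHarnackChain Ω c.hcLow c.hcUp c.hcLen
  adr : IsADR (frontier Ω) c.adr

/-! ### Dyadic cubes on the boundary and trees -/

/-- The constants of a dyadic grid.  `scale` is the constant in the restriction
`2^{-k} ≲ diam E` on the generations that are used when `E` is bounded. -/
structure GridConst where
  a₀ : ℝ
  s : ℝ
  C₁ : ℝ
  scale : ℝ
  a₀_pos : 0 < a₀
  s_pos : 0 < s
  C₁_pos : 0 < C₁
  scale_pos : 0 < scale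

/-- `D k`, for `k ∈ ℤ`, are the generations of a dyadic grid on the set `E`. In the last property
the distance to the empty set is `∞`. -/
structure IsDyadicGrid {n : ℕ} (g : GridConst) (E : Set (Pt n))
    (D : ℤ → Set (Set (Pt n))) : Prop where
  borel : ∀ k, ∀ Q ∈ D k, MeasurableSet Q
  subset : ∀ k, ∀ Q ∈ D k, Q ⊆ E
  cover : ∀ k, E = ⋃₀ D k
  nested : ∀ k m, k ≤ m → ∀ Q ∈ D m, ∀ Q' ∈ D k, Q ⊆ Q' ∨ Q ∩ Q' = ∅
  ancestor : ∀ k m, m < k → ∀ Q ∈ D k, ∃! Q', Q' ∈ D m ∧ Q ⊆ Q'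
  diam_le : ∀ k, ∀ Q ∈ D k, Metric.ediam Q ≤ ENNReal.ofReal (g.C₁ * (2 : ℝ) ^ (-k))
  contains_ball : ∀ k, ∀ Q ∈ D k, ∃ x ∈ E, Metric.ball x (g.a₀ * (2 : ℝ) ^ (-k)) ∩ E ⊆ Q
  thin_boundary : ∀ k, ∀ Q ∈ D k, ∀ ϑ : ℝ, 0 < ϑ → ϑ < g.a₀ →
    hausN n {x ∈ Q | Metric.infEDist x (E \ Q) ≤ ENNReal.ofReal (ϑ * (2 : ℝ) ^ (-k))}
      ≤ ENNReal.ofReal (g.C₁ * ϑ ^ g.s) * hausN n Q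

/-- A dyadic cube: a set, together with the generation `k` to which it belongs (which determines
its length `2^{-k}`). -/
structure Cube (n : ℕ) where
  gen : ℤ
  carrier : Set (Pt n)

/-- The length `ℓ(Q) = 2^{-k}` of a cube of generation `k`. -/
def Cube.len {n : ℕ} (Q : Cube n) : ℝ := (2 : ℝ) ^ (-Q.gen)

/-- `Q` is a dyadic sub-cube of `Q'` (possibly `Q'` itself). -/
def Cube.IsSub {n : ℕ} (Q Q' : Cube n) : Prop := Q'.gen ≤ Q.gen ∧ Q.carrier ⊆ Q'.carrier

/-- The collection `𝔻(E)` of all relevant cubes of a grid `D` on `E`: all generations if `E` is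
unbounded, and those with `2^{-k} ≲ diam E` otherwise. -/
def cubes {n : ℕ} (g : GridConst) (E : Set (Pt n)) (D : ℤ → Set (Set (Pt n))) :
    Set (Cube n) :=
  {Q | Q.carrier ∈ D Q.gen ∧
    ENNReal.ofReal Q.len ≤ ENNReal.ofReal g.scale * Metric.ediam E}

/-- `S` is a (semi-coherent) tree of cubes of `DD` with top cube `Q₀`. -/
structure IsTree {n : ℕ} (DD : Set (Cube n)) (Q₀ : Cube n) (S : Set (Cube n)) : Prop where
  subset : S ⊆ DD
  top_mem : Q₀ ∈ S
  le_top : ∀ Q ∈ S, Q.IsSub Q₀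
  coherent : ∀ Q ∈ S, ∀ Q' ∈ DD, Q.IsSub Q' → Q'.IsSub Q₀ → Q' ∈ S

/-! ### Whitney cubes, Whitney regions, sawtooth domains -/

/-- The closed dyadic Euclidean cube
`∏ᵢ [posᵢ 2^{-gen}, (posᵢ + 1) 2^{-gen}]` of `ℝ^{n+1}`. -/
structure Box (n : ℕ) where
  gen : ℤ
  pos : Fin (n + 1) → ℤ

/-- The side length `ℓ(I)`. -/
def Box.len {n : ℕ} (I : Box n) : ℝ := (2 : ℝ) ^ (-I.gen)

/-- The concentric dilate `t I`. -/
def Box.dil {n : ℕ} (t : ℝ) (I : Box n) : Set (Pt n) :=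
  {X | ∀ i, |X i - ((I.pos i : ℝ) + 1 / 2) * I.len| ≤ t * (I.len / 2)}

/-- The cube `I` itself, as a set of points. -/
def Box.toSet {n : ℕ} (I : Box n) : Set (Pt n) := I.dil 1

/-- `W` is a decomposition of `Ω` into closed dyadic Whitney cubes. -/
structure IsWhitney {n : ℕ} (Ω : Set (Pt n)) (W : Set (Box n)) : Prop where
  cover : ⋃ I ∈ W, I.toSet = Ω
  nonoverlap : ∀ I ∈ W, ∀ J ∈ W, I ≠ J → interior I.toSet ∩ interior J.toSet = ∅
  dist_lower : ∀ I ∈ W, 4 * Metric.diam I.toSet ≤ setDist (I.dil 4) (frontier Ω)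
  dist_mono : ∀ I ∈ W, setDist (I.dil 4) (frontier Ω) ≤ setDist I.toSet (frontier Ω)
  dist_upper : ∀ I ∈ W, setDist I.toSet (frontier Ω) ≤ 40 * Metric.diam I.toSet
  touching : ∀ I ∈ W, ∀ J ∈ W, (I.toSet ∩ J.toSet).Nonempty →
    (1 / 4) * Metric.diam I.toSet ≤ Metric.diam J.toSet ∧
      Metric.diam J.toSet ≤ 4 * Metric.diam I.toSet

/-- `a ≈ b` with constant `K`. -/
def Comp (K a b : ℝ) : Prop := K⁻¹ * b ≤ a ∧ a ≤ K * b

/-- A choice of Whitney cubes `WQ Q ⊆ W`, `Q ∈ DD`, that may serve to form the Whitney regions: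
`WQ Q` is nonempty and, with constant `K`, for `I ∈ WQ Q` and `I^* = (1 + τ) I`,
`ℓ(I) ≈ dist(Q, I) ≈ dist(Q, I^*) ≈ dist(∂Ω, I^*) ≈ ℓ(Q)`. -/
structure IsWhitneyChoice {n : ℕ} (K τ : ℝ) (Ω : Set (Pt n)) (DD : Set (Cube n))
    (W : Set (Box n)) (WQ : Cube n → Set (Box n)) : Prop where
  subset : ∀ Q ∈ DD, WQ Q ⊆ W
  nonempty : ∀ Q ∈ DD, (WQ Q).Nonempty
  len : ∀ Q ∈ DD, ∀ I ∈ WQ Q, Comp K I.len Q.len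
  dist_box : ∀ Q ∈ DD, ∀ I ∈ WQ Q, Comp K (setDist Q.carrier I.toSet) Q.len
  dist_fat : ∀ Q ∈ DD, ∀ I ∈ WQ Q, Comp K (setDist Q.carrier (I.dil (1 + τ))) Q.len
  dist_bdry : ∀ Q ∈ DD, ∀ I ∈ WQ Q, Comp K (setDist (frontier Ω) (I.dil (1 + τ))) Q.len

/-- The Whitney region `U_Q = ⋃_{I ∈ W(Q)} I^*`, with `I^* = (1 + τ) I`. -/
def region {n : ℕ} (τ : ℝ) (WQ : Cube n → Set (Box n)) (Q : Cube n) : Set (Pt n) :=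
  ⋃ I ∈ WQ Q, I.dil (1 + τ)

/-- The sawtooth domain `Ω_S = int (⋃_{Q ∈ S} U_Q)`. -/
def sawtooth {n : ℕ} (τ : ℝ) (WQ : Cube n → Set (Box n)) (S : Set (Cube n)) : Set (Pt n) :=
  interior (⋃ Q ∈ S, region τ WQ Q)

/-- The cubes `Q' ∈ 𝔻` with `1/M ≤ ℓ(Q')/ℓ(Q) ≤ M` and `dist(Q, Q') ≤ M diam Q`. -/
def nearCubes {n : ℕ} (DD : Set (Cube n)) (M : ℝ) (Q : Cube n) : Set (Cube n) :=
  {Q' ∈ DD | 1 / M ≤ Q'.len / Q.len ∧ Q'.len / Q.len ≤ M ∧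
    setDist Q.carrier Q'.carrier ≤ M * Metric.diam Q.carrier}

/-- The `M`-fattened Whitney region `U_Q^M`. -/
def fatRegion {n : ℕ} (τ : ℝ) (WQ : Cube n → Set (Box n)) (DD : Set (Cube n)) (M : ℝ)
    (Q : Cube n) : Set (Pt n) :=
  ⋃ Q' ∈ nearCubes DD M Q, region τ WQ Q'

/-! ### Square functions -/

/-- The dyadic square function restricted to the tree `S`,
`x ↦ (∑_{Q ∈ S} 1_Q(x) ∫_{U_Q^M} |F(Y)|² δ(Y)^{1-n} dY)^{1/2}`. -/
def treeSquare {n : ℕ} (Ω : Set (Pt n)) (τ : ℝ) (WQ : Cube n → Set (Box n))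
    (DD : Set (Cube n)) (M : ℝ) (S : Set (Cube n)) (F : Pt n → Pt n) (x : Pt n) : ℝ≥0∞ :=
  (∑' Q : S, (Q : Cube n).carrier.indicator
    (fun _ => ∫⁻ Y in fatRegion τ WQ DD M Q,
      ‖F Y‖ₑ ^ 2 * ENNReal.ofReal (bdist Ω Y ^ (1 - (n : ℤ)))) x) ^ (1 / 2 : ℝ)

/-- The cone `Γ(z) = {Y ∈ Ω : |z - Y| < 10 dist(Y, ∂Ω)}` in a domain `Ω`. -/
def cone {n : ℕ} (Ω : Set (Pt n)) (z : Pt n) : Set (Pt n) :=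
  {Y ∈ Ω | dist z Y < 10 * bdist Ω Y}

/-- The conical square function
`z ↦ (∫_{Γ(z)} |F(Y)|² dist(Y, ∂Ω)^{1-n} dY)^{1/2}` of a domain `Ω`. -/
def conicalSquare {n : ℕ} (Ω : Set (Pt n)) (F : Pt n → Pt n) (z : Pt n) : ℝ≥0∞ :=
  (∫⁻ Y in cone Ω z, ‖F Y‖ₑ ^ 2 * ENNReal.ofReal (bdist Ω Y ^ (1 - (n : ℤ)))) ^ (1 / 2 : ℝ)

end Sawtooth

end

open Sawtooth

namespace Sawtooth

variable {n : ℕ}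

/-! ### Distances -/

/-! The bound holds at every `z ∈ ∂Ω_S`. With `ε = δ(z)/2`, the cone at `z` is split at `|z - Y| =
ε`.

Far part, `|z - Y| ≥ ε`: here `δ(Y) ≤ 3|z - Y| < 30 δ_⋆(Y)`, so `δ` may replace `δ_⋆` in the weight.
Pick `Z ∈ Ω_S` within `ε` of `z`, in the region of some `P ∈ S`. If `Y` lies in the region of `Q ∈
S`, then `ℓ(P) ≲ δ(Z) ≲ ε ≤ |z - Y| ≲ δ(Y) ≲ ℓ(Q)`, so the ancestor `Q'` of `P` of length `max
(ℓ(P), ℓ(Q))` belongs to `S` and is near `Q`, that is, `Y ∈ U_{Q'}^M` (`exists_mem_fatRegion`).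
Every such `Q'` contains `P`, so the dyadic square function at any point of `P` controls the far
integral, and `σ(P) > 0` gives a point where it is at most its essential supremum
(`lintegral_far_le`).

Near part, `|z - Y| < ε`: here `δ(Y) ≥ ε`, so `|B| ≤ T/ε` a.e., where `T` is the essential supremum
of `δ|B|`, while `δ_⋆(Y)^{1-n} ≲ |z - Y|^{1-n}` integrates to `≲ ε²` (`lintegral_near_le`). If `δ(z)
= 0` there is no near part, and the far bound is used with `ε → 0`. -/

lemma setDist_le_dist {A F : Set (Pt n)} {a b : Pt n} (ha : a ∈ A) (hb : b ∈ F) :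
    setDist A F ≤ dist a b :=
  csInf_le ⟨0, by rintro r ⟨a, -, b, -, rfl⟩; exact dist_nonneg⟩ ⟨a, ha, b, hb, rfl⟩

lemma exists_dist_lt_of_setDist_lt {A F : Set (Pt n)} (hA : A.Nonempty) (hF : F.Nonempty)
    {r : ℝ} (h : setDist A F < r) : ∃ a ∈ A, ∃ b ∈ F, dist a b < r := by
  obtain ⟨a, ha⟩ := hA
  obtain ⟨b, hb⟩ := hF
  obtain ⟨_, ⟨a', ha', b', hb', rfl⟩, hlt⟩ := exists_lt_of_csInf_lt
    (s := {r : ℝ | ∃ a ∈ A, ∃ b ∈ F, r = dist a b}) ⟨_, a, ha, b, hb, rfl⟩ h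
  exact ⟨a', ha', b', hb', hlt⟩

/-- A nearest point of the complement lies on the frontier. -/
lemma bdist_le_dist_of_notMem {U : Set (Pt n)} {X Y : Pt n} (hX : X ∈ U) (hY : Y ∉ U) :
    bdist U X ≤ dist X Y := by
  obtain ⟨y, hy, h⟩ := exists_mem_frontier_infDist_compl_eq_dist hX
    (fun h => hY (h ▸ mem_univ Y))
  calc bdist U X ≤ dist X y := Metric.infDist_le_dist_of_mem hy
    _ = Metric.infDist X Uᶜ := h.symm
    _ ≤ dist X Y := Metric.infDist_le_dist_of_mem hY

lemma bdist_mono {U V : Set (Pt n)} (hV : IsOpen V) (hUV : U ⊆ V) (hne : (frontier V).Nonempty)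
    {X : Pt n} (hX : X ∈ U) : bdist U X ≤ bdist V X := by
  refine (Metric.le_infDist hne).2 fun p hp => bdist_le_dist_of_notMem hX fun h => ?_
  rw [hV.frontier_eq] at hp
  exact hp.2 (hUV h)

lemma subset_of_isPreconnected_of_disjoint_frontier {U V : Set (Pt n)} (hV : IsOpen V)
    (hU : IsPreconnected U) (hne : (U ∩ V).Nonempty) (hd : Disjoint U (frontier V)) : U ⊆ V := by
  refine hU.subset_left_of_subset_union hV isClosed_closure.isOpen_compl
    (disjoint_compl_right.mono_left subset_closure) (fun x hx => ?_) hne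
  by_cases h : x ∈ V
  · exact Or.inl h
  · refine Or.inr fun hc => disjoint_left.1 hd hx ?_
    rw [hV.frontier_eq]
    exact ⟨hc, h⟩

lemma bdist_le_add (U : Set (Pt n)) (X Y : Pt n) : bdist U X ≤ bdist U Y + dist X Y :=
  Metric.infDist_le_infDist_add_dist

/-! ### Whitney boxes -/

lemma Box.len_pos (I : Box n) : 0 < I.len := zpow_pos two_pos _

lemma Cube.len_pos (Q : Cube n) : 0 < Q.len := zpow_pos two_pos _

lemma Box.dil_mono (I : Box n) {s t : ℝ} (h : s ≤ t) : I.dil s ⊆ I.dil t := fun _ hX i =>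
  (hX i).trans (mul_le_mul_of_nonneg_right h (half_pos I.len_pos).le)

lemma Box.nonempty_dil (I : Box n) {t : ℝ} (ht : 0 ≤ t) : (I.dil t).Nonempty := by
  refine ⟨WithLp.toLp 2 fun i => ((I.pos i : ℝ) + 1 / 2) * I.len, fun i => ?_⟩
  simpa using mul_nonneg ht (half_pos I.len_pos).le

lemma Box.convex_dil (I : Box n) (t : ℝ) : Convex ℝ (I.dil t) := by
  intro X hX Y hY a b ha hb hab i
  have h1 := hX i
  have h2 := hY i
  generalize ((I.pos i : ℝ) + 1 / 2) * I.len = q at h1 h2 ⊢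
  have : (a • X + b • Y) i - q = a * (X i - q) + b * (Y i - q) := by
    simp only [PiLp.add_apply, PiLp.smul_apply, smul_eq_mul]
    linear_combination q * hab
  rw [this]
  calc |a * (X i - q) + b * (Y i - q)| ≤ |a * (X i - q)| + |b * (Y i - q)| := abs_add_le _ _
    _ = a * |X i - q| + b * |Y i - q| := by rw [abs_mul, abs_mul, abs_of_nonneg ha, abs_of_nonneg hb]
    _ ≤ a * (t * (I.len / 2)) + b * (t * (I.len / 2)) := by gcongr
    _ = t * (I.len / 2) := by rw [← add_mul, hab, one_mul]

lemma Box.dist_le_of_mem_dil (I : Box n) {t : ℝ} {X Y : Pt n} (hX : X ∈ I.dil t)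
    (hY : Y ∈ I.dil t) : dist X Y ≤ (n + 1) * (t * I.len) := by
  have h : ∀ i, dist (X i) (Y i) ≤ t * I.len := fun i => by
    have h1 := abs_le.1 (hX i)
    have h2 := abs_le.1 (hY i)
    rw [Real.dist_eq, abs_le]
    constructor <;> linarith [h1.1, h1.2, h2.1, h2.2]
  have h0 : 0 ≤ t * I.len := dist_nonneg.trans (h 0)
  rw [EuclideanSpace.dist_eq]
  refine Real.sqrt_le_iff.2 ⟨by positivity, ?_⟩
  calc ∑ i, dist (X i) (Y i) ^ 2 ≤ ∑ _i : Fin (n + 1), (t * I.len) ^ 2 :=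
        Finset.sum_le_sum fun i _ => by gcongr; exact h i
    _ = (n + 1) * (t * I.len) ^ 2 := by simp
    _ ≤ ((n + 1) * (t * I.len)) ^ 2 := by
        rw [mul_pow ((n : ℝ) + 1)]
        have : (n : ℝ) + 1 ≤ (n + 1) ^ 2 := by nlinarith [(Nat.cast_nonneg n : (0 : ℝ) ≤ n)]
        exact mul_le_mul_of_nonneg_right this (sq_nonneg _)

/-- The constant in the comparison of points of a Whitney region `U_Q` with points of `Q`. -/
def regionConst (n : ℕ) (K : ℝ) : ℝ := K + (n + 1) * (2 * K) + 1

lemma regionConst_ge {K : ℝ} (hK : 1 ≤ K) : 1 ≤ regionConst n K := by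
  have : 0 ≤ ((n : ℝ) + 1) * (2 * K) := by positivity
  unfold regionConst
  linarith

section Region

variable {K τ : ℝ} {Ω : Set (Pt n)} {DD : Set (Cube n)} {W : Set (Box n)}
  {WQ : Cube n → Set (Box n)}

lemma len_le_of_mem_region (hK : 1 ≤ K) (hWQ : IsWhitneyChoice K τ Ω DD W WQ)
    (hne : (frontier Ω).Nonempty) {Q : Cube n} (hQ : Q ∈ DD) {Y : Pt n}
    (hY : Y ∈ region τ WQ Q) : Q.len ≤ K * bdist Ω Y := by
  simp only [region, mem_iUnion] at hY
  obtain ⟨I, hI, hY⟩ := hY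
  have h : K⁻¹ * Q.len ≤ bdist Ω Y := (Metric.le_infDist hne).2 fun p hp => by
    rw [dist_comm]
    exact (hWQ.dist_bdry Q hQ I hI).1.trans (setDist_le_dist hp hY)
  rwa [inv_mul_le_iff₀ (by linarith)] at h

lemma exists_dist_le_of_mem_region (hτ : 0 < τ) (hτ1 : τ ≤ 1)
    (hWQ : IsWhitneyChoice K τ Ω DD W WQ) {Q : Cube n} (hQ : Q ∈ DD)
    (hQn : Q.carrier.Nonempty) {Y : Pt n} (hY : Y ∈ region τ WQ Q) :
    ∃ q ∈ Q.carrier, dist Y q ≤ regionConst n K * Q.len := by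
  simp only [region, mem_iUnion] at hY
  obtain ⟨I, hI, hY⟩ := hY
  have hl := Q.len_pos
  -- The infimum need not be attained; the slack `ℓ(Q)` is the summand `1` in `regionConst`.
  obtain ⟨q, hq, X, hX, h⟩ := exists_dist_lt_of_setDist_lt hQn
    (I.nonempty_dil (t := 1 + τ) (by linarith))
    (lt_of_le_of_lt (hWQ.dist_fat Q hQ I hI).2 (lt_add_of_pos_right _ hl))
  refine ⟨q, hq, ?_⟩
  have h1 := I.dist_le_of_mem_dil hY hX
  have h2 : (1 + τ) * I.len ≤ 2 * (K * Q.len) :=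
    mul_le_mul (by linarith) (hWQ.len Q hQ I hI).2 I.len_pos.le (by norm_num)
  have h3 : ((n : ℝ) + 1) * ((1 + τ) * I.len) ≤ (n + 1) * (2 * (K * Q.len)) := by gcongr
  have h4 := dist_triangle Y X q
  rw [dist_comm X q] at h4
  unfold regionConst
  linarith

/-- Each dilate is convex, meets `Ω` in its own Whitney cube and avoids the frontier by `dist_bdry`,
so it cannot leave `Ω`. -/
lemma region_subset (hK : 1 ≤ K) (hΩ : IsOpen Ω) (hne : (frontier Ω).Nonempty) (hτ : 0 < τ)
    (hW : IsWhitney Ω W) (hWQ : IsWhitneyChoice K τ Ω DD W WQ) {Q : Cube n} (hQ : Q ∈ DD) :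
    region τ WQ Q ⊆ Ω := by
  refine iUnion₂_subset fun I hI => subset_of_isPreconnected_of_disjoint_frontier hΩ
    (I.convex_dil _).isPreconnected ?_ (disjoint_left.2 fun Y hY hYf => ?_)
  · obtain ⟨X, hX⟩ := I.nonempty_dil zero_le_one
    refine ⟨X, I.dil_mono (by linarith) hX, ?_⟩
    rw [← hW.cover]
    exact mem_biUnion (hWQ.subset Q hQ hI) hX
  · have h := len_le_of_mem_region hK hWQ hne hQ (mem_biUnion hI hY)
    rw [bdist, Metric.infDist_zero_of_mem hYf, mul_zero] at h
    exact h.not_gt Q.len_pos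

lemma sawtooth_subset (hK : 1 ≤ K) (hΩ : IsOpen Ω) (hne : (frontier Ω).Nonempty) (hτ : 0 < τ)
    (hW : IsWhitney Ω W) (hWQ : IsWhitneyChoice K τ Ω DD W WQ) {S : Set (Cube n)} (hS : S ⊆ DD) :
    sawtooth τ WQ S ⊆ Ω :=
  interior_subset.trans (iUnion₂_subset fun _ hQ => region_subset hK hΩ hne hτ hW hWQ (hS hQ))

end Region

/-! ### Dyadic cubes -/

section Grid

variable {g : GridConst} {E : Set (Pt n)} {D : ℤ → Set (Set (Pt n))} {C : ℝ}

/-- A radius, relative to the length of a cube, of balls in which the boundary is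
Ahlfors-David regular. -/
noncomputable def ballConst (g : GridConst) : ℝ := min g.a₀ (1 / (2 * g.scale))

lemma ballConst_pos (g : GridConst) : 0 < ballConst g :=
  lt_min g.a₀_pos (one_div_pos.2 (mul_pos two_pos g.scale_pos))

/-- Ahlfors regularity needs radii strictly below the diameter; the `2` in `ballConst` provides
this. -/
lemma ofReal_lt_ediam {Q : Cube n} (hQ : Q ∈ cubes g E D) {r : ℝ} (hr : r ≤ ballConst g * Q.len) :
    ENNReal.ofReal r < Metric.ediam E := by
  rcases eq_or_ne (Metric.ediam E) ⊤ with h | h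
  · exact h ▸ ENNReal.ofReal_lt_top
  have hl := Q.len_pos
  have h1 := hQ.2
  rw [← ENNReal.ofReal_toReal h, ← ENNReal.ofReal_mul g.scale_pos.le] at h1
  have h0 : 0 ≤ g.scale * (Metric.ediam E).toReal := by have := g.scale_pos; positivity
  rw [ENNReal.ofReal_le_ofReal_iff h0] at h1
  have hd : 0 < (Metric.ediam E).toReal :=
    (pos_iff_pos_of_mul_pos (hl.trans_le h1)).1 g.scale_pos
  rw [← ENNReal.ofReal_toReal h, ENNReal.ofReal_lt_ofReal_iff hd]
  calc r ≤ 1 / (2 * g.scale) * Q.len := hr.trans (by gcongr; exact min_le_right _ _)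
    _ ≤ 1 / (2 * g.scale) * (g.scale * (Metric.ediam E).toReal) := by
        have := g.scale_pos
        gcongr
    _ = (Metric.ediam E).toReal / 2 := by have := g.scale_pos.ne'; field_simp
    _ < _ := half_lt_self hd

lemma exists_ball_subset (hD : IsDyadicGrid g E D) {Q : Cube n} (hQ : Q ∈ cubes g E D) :
    ∃ x ∈ Q.carrier, x ∈ E ∧ E ∩ Metric.ball x (ballConst g * Q.len) ⊆ Q.carrier := by
  obtain ⟨x, hx, h⟩ := hD.contains_ball _ _ hQ.1
  have hl := Q.len_pos
  refine ⟨x, h ⟨Metric.mem_ball_self (mul_pos g.a₀_pos hl), hx⟩, hx, fun y hy => h ⟨?_, hy.1⟩⟩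
  exact Metric.ball_subset_ball (by unfold Cube.len; gcongr; exact min_le_left _ _) hy.2

lemma hausN_pos (hC : 1 ≤ C) (hE : IsADR E C) (hD : IsDyadicGrid g E D) {Q : Cube n}
    (hQ : Q ∈ cubes g E D) : 0 < hausN n Q.carrier := by
  obtain ⟨x, -, hx, h⟩ := exists_ball_subset hD hQ
  have hr := mul_pos (ballConst_pos g) Q.len_pos
  refine lt_of_lt_of_le ?_ (((hE.2 x hx _ hr (ofReal_lt_ediam hQ le_rfl)).1).trans (measure_mono h))
  have : 0 < C := by linarith
  exact ENNReal.ofReal_pos.2 (by positivity)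

/-- The constant in the lower bound of the diameter of a cube by its length. -/
noncomputable def diamConst (g : GridConst) (C : ℝ) : ℝ := ballConst g / (2 * C ^ 2)

lemma diamConst_pos (g : GridConst) (hC : 1 ≤ C) : 0 < diamConst g C :=
  div_pos (ballConst_pos g) (by positivity)

/-- Needed because `nearCubes` measures distances by the diameter, not the length. Were the diameter
smaller, the surface balls of radii `r = ballConst g * Q.len` and `r / (2C²)` about `x` would
coincide, and regularity would give `C⁻¹ rⁿ ≤ C (r / (2C²))ⁿ ≤ C⁻¹ rⁿ / 2`. -/
lemma diamConst_mul_len_le_diam (hn : n ≠ 0) (hC : 1 ≤ C) (hE : IsADR E C)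
    (hD : IsDyadicGrid g E D) {Q : Cube n} (hQ : Q ∈ cubes g E D) :
    diamConst g C * Q.len ≤ Metric.diam Q.carrier := by
  by_contra! hlt
  obtain ⟨x, hxQ, hx, h⟩ := exists_ball_subset hD hQ
  have hl := Q.len_pos
  have ha := ballConst_pos g
  have hd := diamConst_pos g hC
  have hC0 : 0 < C := by linarith
  have hC2 : 1 ≤ 2 * C ^ 2 := by nlinarith
  have hb : Bornology.IsBounded Q.carrier :=
    Metric.isBounded_iff_ediam_ne_top.2 ((hD.diam_le _ _ hQ.1).trans_lt ENNReal.ofReal_lt_top).ne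
  have hda : diamConst g C ≤ ballConst g := div_le_self ha.le hC2
  have hsub : E ∩ Metric.ball x (ballConst g * Q.len) ⊆
      E ∩ Metric.ball x (diamConst g C * Q.len) := fun y hy =>
    ⟨hy.1, (Metric.dist_le_diam_of_mem hb (h hy) hxQ).trans_lt hlt⟩
  have h1 := (hE.2 x hx _ (mul_pos ha hl) (ofReal_lt_ediam hQ le_rfl)).1.trans
    ((measure_mono hsub).trans
      (hE.2 x hx _ (mul_pos hd hl) (ofReal_lt_ediam hQ (by gcongr))).2)
  rw [ENNReal.ofReal_le_ofReal_iff (by positivity)] at h1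
  have h2 : (diamConst g C * Q.len) ^ n ≤ (ballConst g * Q.len) ^ n / (2 * C ^ 2) := by
    have : diamConst g C * Q.len = (ballConst g * Q.len) / (2 * C ^ 2) := by
      unfold diamConst; ring
    rw [this, div_pow]
    gcongr
    exact le_self_pow₀ hC2 hn
  have h3 : 0 < (ballConst g * Q.len) ^ n := by positivity
  have h4 : C * ((ballConst g * Q.len) ^ n / (2 * C ^ 2))
      = C⁻¹ * (ballConst g * Q.len) ^ n / 2 := by field_simp
  have h5 : 0 < C⁻¹ * (ballConst g * Q.len) ^ n := by positivity
  have h6 := h1.trans (mul_le_mul_of_nonneg_left h2 hC0.le)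
  linarith

lemma IsDyadicGrid.carrier_subset (hD : IsDyadicGrid g E D) {Q Q' : Cube n}
    (hQ : Q ∈ cubes g E D) (hQ' : Q' ∈ cubes g E D) (hgen : Q'.gen ≤ Q.gen)
    (hne : (Q.carrier ∩ Q'.carrier).Nonempty) : Q.carrier ⊆ Q'.carrier :=
  (hD.nested _ _ hgen _ hQ.1 _ hQ'.1).resolve_right hne.ne_empty

/-- At most one cube of each generation contains `x`. Countability permits subadditivity of the
integral over the fattened regions. -/
lemma countable_containing (hD : IsDyadicGrid g E D) {S : Set (Cube n)} (hS : S ⊆ cubes g E D)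
    (x : Pt n) : Countable {Q : S // x ∈ Q.1.carrier} := by
  refine Function.Injective.countable (f := fun Q => Q.1.1.gen) fun Q R h => ?_
  obtain ⟨⟨⟨k, A⟩, hQ⟩, hxQ⟩ := Q
  obtain ⟨⟨⟨m, B⟩, hR⟩, hxR⟩ := R
  obtain rfl : k = m := h
  have : A = B := (hD.carrier_subset (hS hQ) (hS hR) le_rfl ⟨x, hxQ, hxR⟩).antisymm
    (hD.carrier_subset (hS hR) (hS hQ) le_rfl ⟨x, hxR, hxQ⟩)
  subst this
  rfl

lemma len_le_len {Q Q' : Cube n} (h : Q'.gen ≤ Q.gen) : Q.len ≤ Q'.len :=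
  zpow_le_zpow_right₀ one_le_two (neg_le_neg h)

lemma exists_ancestor (hD : IsDyadicGrid g E D) {Q₀ : Cube n} {S : Set (Cube n)}
    (hS : IsTree (cubes g E D) Q₀ S) {Q : Cube n} (hQ : Q ∈ S) (hQn : Q.carrier.Nonempty)
    {m : ℤ} (h0 : Q₀.gen ≤ m) (hm : m ≤ Q.gen) :
    ∃ Q' ∈ S, Q'.gen = m ∧ Q.carrier ⊆ Q'.carrier := by
  obtain ⟨A, hA, hQA⟩ : ∃ A ∈ D m, Q.carrier ⊆ A := by
    rcases hm.lt_or_eq with h | rfl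
    · obtain ⟨A, hA, -⟩ := hD.ancestor _ _ h _ (hS.subset hQ).1
      exact ⟨A, hA⟩
    · exact ⟨_, (hS.subset hQ).1, subset_rfl⟩
  have hQ0 := hS.subset hS.top_mem
  -- The ancestor is no longer than `Q₀`, so it inherits the restriction on scales.
  have hmem : (⟨m, A⟩ : Cube n) ∈ cubes g E D :=
    ⟨hA, (ENNReal.ofReal_le_ofReal (len_le_len (Q := ⟨m, A⟩) h0)).trans hQ0.2⟩
  obtain ⟨x, hx⟩ := hQn
  exact ⟨⟨m, A⟩, hS.coherent Q hQ _ hmem ⟨hm, hQA⟩ ⟨h0, hD.carrier_subset hmem hQ0 h0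
    ⟨x, hQA hx, (hS.le_top Q hQ).2 hx⟩⟩, rfl, hQA⟩

end Grid

/-! ### The part of the square function far from the vertex -/

section Far

variable {K τ : ℝ} {Ω : Set (Pt n)} {W : Set (Box n)} {WQ : Cube n → Set (Box n)}
  {g : GridConst} {D : ℤ → Set (Set (Pt n))} {S : Set (Cube n)} {Q₀ : Cube n} {C : ℝ}

/-- How much the Whitney regions of the dyadic square function have to be fattened. -/
noncomputable def fatConst (n : ℕ) (K : ℝ) (g : GridConst) (C : ℝ) : ℝ :=
  max (max 2 (30 * K * regionConst n K)) (22 * regionConst n K / diamConst g C)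

lemma exists_mem_fatRegion (hn : n ≠ 0) (hC : 1 ≤ C) (hE : IsADR (frontier Ω) C)
    (hD : IsDyadicGrid g (frontier Ω) D) (hK : 1 ≤ K) (hτ : 0 < τ) (hτ1 : τ ≤ 1)
    (hWQ : IsWhitneyChoice K τ Ω (cubes g (frontier Ω) D) W WQ)
    (hS : IsTree (cubes g (frontier Ω) D) Q₀ S) (hne : (frontier Ω).Nonempty)
    {M : ℝ} (hM : fatConst n K g C ≤ M) {ε : ℝ} {z Z Y : Pt n} {P Q : Cube n}
    (hz : bdist Ω z ≤ 2 * ε) (hP : P ∈ S) (hZ : Z ∈ region τ WQ P) (hZz : dist Z z < ε)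
    (hQ : Q ∈ S) (hY : Y ∈ region τ WQ Q) (hεY : ε ≤ dist z Y)
    (hYz : dist z Y < 10 * bdist Ω Y) :
    ∃ Q' ∈ S, P.carrier ⊆ Q'.carrier ∧
      Y ∈ fatRegion τ WQ (cubes g (frontier Ω) D) M Q' := by
  have hcube : ∀ {Q}, Q ∈ S → Q.carrier.Nonempty := fun {Q} hQ => by
    obtain ⟨x, hx, -⟩ := exists_ball_subset hD (hS.subset hQ)
    exact ⟨x, hx⟩
  obtain ⟨Q', hQ', hgen, hsub⟩ := exists_ancestor hD hS hP (hcube hP)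
    (le_min (hS.le_top Q hQ).1 (hS.le_top P hP).1) (min_le_right Q.gen P.gen)
  refine ⟨Q', hQ', hsub, mem_biUnion (x := Q) ⟨hS.subset hQ, ?_⟩ hY⟩
  set A := regionConst n K with hA
  have hA1 : 1 ≤ A := regionConst_ge hK
  obtain ⟨p, hp, hpZ⟩ := exists_dist_le_of_mem_region hτ hτ1 hWQ (hS.subset hP) (hcube hP) hZ
  obtain ⟨q, hq, hqY⟩ := exists_dist_le_of_mem_region hτ hτ1 hWQ (hS.subset hQ) (hcube hQ) hY
  rw [← hA] at hpZ hqY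
  have hPlen := len_le_of_mem_region hK hWQ hne (hS.subset hP) hZ
  have hZb := bdist_le_add Ω Z z
  have hYA : bdist Ω Y ≤ A * Q.len :=
    (Metric.infDist_le_dist_of_mem (hD.subset _ _ (hS.subset hQ).1 hq)).trans hqY
  have hP0 := P.len_pos
  have hQ0 := Q.len_pos
  have hQ'0 := Q'.len_pos
  have hPQ' : P.len ≤ Q'.len := len_le_len (hgen.trans_le (min_le_right _ _))
  have hQQ' : Q.len ≤ Q'.len := len_le_len (hgen.trans_le (min_le_left _ _))
  have hKA : 1 ≤ K * A := one_le_mul_of_one_le_of_one_le hK hA1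
  -- `ℓ(P) ≤ K δ(Z) ≤ 3Kε ≤ 3K|z - Y| ≤ 30K δ(Y) ≤ 30KA ℓ(Q)`.
  have hPQ : P.len ≤ 30 * K * A * Q.len := by
    calc P.len ≤ K * (30 * (A * Q.len)) := hPlen.trans (by gcongr; linarith)
      _ = _ := by ring
  have hQ'Q : Q'.len ≤ 30 * K * A * Q.len := by
    rcases min_choice Q.gen P.gen with h | h
    · calc Q'.len = 1 * Q.len := by unfold Cube.len; rw [hgen, h, one_mul]
        _ ≤ _ := by gcongr; linarith
    · calc Q'.len = P.len := by unfold Cube.len; rw [hgen, h]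
        _ ≤ _ := hPQ
  have hM2 : 2 ≤ M := ((le_max_left _ _).trans (le_max_left _ _)).trans hM
  have hM30 : 30 * K * A ≤ M := ((le_max_right _ _).trans (le_max_left _ _)).trans hM
  have hM22 : 22 * A / diamConst g C ≤ M := (le_max_right _ _).trans hM
  refine ⟨?_, ?_, ?_⟩
  · rw [div_le_div_iff₀ (by linarith) hQ'0, one_mul, mul_comm]
    exact hQ'Q.trans (by gcongr)
  · rw [div_le_iff₀ hQ'0]
    nlinarith
  -- Along `p, Z, z, Y, q` the four distances are at most `A`, `10A`, `10A`, `A` times `ℓ(Q')`,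
  -- because `ε ≤ |z - Y| ≤ 10 δ(Y) ≤ 10A ℓ(Q)`.
  · have h1 : setDist Q'.carrier Q.carrier ≤ 22 * A * Q'.len := by
      have hA0 : 0 ≤ A := by linarith
      have e1 : A * P.len ≤ A * Q'.len := by gcongr
      have e2 : A * Q.len ≤ A * Q'.len := by gcongr
      have t1 := dist_triangle4 p Z z Y
      have t2 := dist_triangle p Y q
      have t3 := setDist_le_dist (hsub hp) hq
      rw [dist_comm p Z] at t1
      linarith
    have h2 := diamConst_mul_len_le_diam hn hC hE hD (hS.subset hQ')
    have hd := diamConst_pos g hC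
    rw [div_le_iff₀ hd] at hM22
    calc _ ≤ 22 * A * Q'.len := h1
      _ ≤ M * diamConst g C * Q'.len := by gcongr
      _ = M * (diamConst g C * Q'.len) := by ring
      _ ≤ _ := by gcongr

/-- The exponent `1 - n` is nonpositive, so an upper bound for `a` becomes one for the weight of
`b`. This performs every exchange of distances in the weights. -/
lemma ofReal_zpow_le {a b t : ℝ} (ha : 0 < a) (ht : 0 < t) (h : a ≤ t * b) (hn : 1 ≤ n) :
    ENNReal.ofReal (b ^ (1 - (n : ℤ))) ≤
      ENNReal.ofReal (t ^ (n - 1)) * ENNReal.ofReal (a ^ (1 - (n : ℤ))) := by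
  rw [← ENNReal.ofReal_mul (by positivity)]
  refine ENNReal.ofReal_le_ofReal ?_
  have hb : 0 < b := (pos_iff_pos_of_mul_pos (ha.trans_le h)).1 ht
  have he : (1 - (n : ℤ)) = -((n - 1 : ℕ) : ℤ) := by omega
  rw [he, zpow_neg, zpow_neg, zpow_natCast, zpow_natCast, ← div_eq_mul_inv,
    inv_le_comm₀ (by positivity) (by positivity), inv_div, div_le_iff₀ (by positivity), mul_comm,
    ← mul_pow]
  gcongr

/-- The set where `G` exceeds its essential supremum is null, whereas `P` has positive measure. -/
lemma exists_mem_treeSquare_le (hC : 1 ≤ C) (hE : IsADR (frontier Ω) C)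
    (hD : IsDyadicGrid g (frontier Ω) D) (hS : IsTree (cubes g (frontier Ω) D) Q₀ S)
    (G : Pt n → ℝ≥0∞) {P : Cube n} (hP : P ∈ S) :
    ∃ x ∈ P.carrier, G x ≤ essSup G ((surf Ω).restrict Q₀.carrier) := by
  by_contra! h
  have hae := ENNReal.ae_le_essSup (μ := (surf Ω).restrict Q₀.carrier) G
  have hm : MeasurableSet P.carrier := hD.borel _ _ (hS.subset hP).1
  have h0 : (surf Ω).restrict Q₀.carrier P.carrier = 0 :=
    measure_mono_null (fun x hx => (h x hx).not_ge) hae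
  rw [Measure.restrict_apply hm, inter_eq_left.2 (hS.le_top P hP).2, surf,
    Measure.restrict_apply hm, inter_eq_left.2 (hD.subset _ _ (hS.subset hP).1)] at h0
  exact (hausN_pos hC hE hD (hS.subset hP)).ne' h0

lemma lintegral_far_le (hn : n ≠ 0) (hC : 1 ≤ C) (hΩ : IsOpen Ω) (hE : IsADR (frontier Ω) C)
    (hD : IsDyadicGrid g (frontier Ω) D) (hK : 1 ≤ K) (hτ : 0 < τ) (hτ1 : τ ≤ 1)
    (hW : IsWhitney Ω W) (hWQ : IsWhitneyChoice K τ Ω (cubes g (frontier Ω) D) W WQ)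
    (hS : IsTree (cubes g (frontier Ω) D) Q₀ S) (hne : (frontier Ω).Nonempty)
    {M : ℝ} (hM : fatConst n K g C ≤ M) (B : Pt n → Pt n) {ε : ℝ} (hε : 0 < ε) {z : Pt n}
    (hz : bdist Ω z ≤ 2 * ε) (hzS : z ∈ closure (sawtooth τ WQ S)) :
    ∫⁻ Y in cone (sawtooth τ WQ S) z ∩ {Y | ε ≤ dist z Y},
        ‖B Y‖ₑ ^ 2 * ENNReal.ofReal (bdist (sawtooth τ WQ S) Y ^ (1 - (n : ℤ))) ≤
      ENNReal.ofReal (30 ^ (n - 1)) *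
        essSup (treeSquare Ω τ WQ (cubes g (frontier Ω) D) M S B)
          ((surf Ω).restrict Q₀.carrier) ^ 2 := by
  set DD := cubes g (frontier Ω) D
  set U := sawtooth τ WQ S
  have hUΩ : U ⊆ Ω := sawtooth_subset hK hΩ hne hτ hW hWQ hS.subset
  have hUreg : ∀ Y ∈ U, ∃ Q ∈ S, Y ∈ region τ WQ Q := fun Y hY => by
    simpa using interior_subset hY
  -- `Z`, `P` and `x` are fixed before `Y`, so a single `x` serves the whole far part.
  obtain ⟨Z, hZU, hZz⟩ := Metric.mem_closure_iff.1 hzS ε hε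
  rw [dist_comm] at hZz
  obtain ⟨P, hP, hZ⟩ := hUreg Z hZU
  obtain ⟨x, hxP, hx⟩ := exists_mem_treeSquare_le hC hE hD hS (treeSquare Ω τ WQ DD M S B) hP
  let f : Pt n → ℝ≥0∞ := fun Y => ‖B Y‖ₑ ^ 2 * ENNReal.ofReal (bdist Ω Y ^ (1 - (n : ℤ)))
  have hcount := countable_containing hD hS.subset x
  have hsub : cone U z ∩ {Y | ε ≤ dist z Y} ⊆
      (cone U z ∩ {Y | ε ≤ dist z Y}) ∩
        ⋃ Q : {Q : S // x ∈ Q.1.carrier}, fatRegion τ WQ DD M Q.1.1 := by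
    intro Y hY
    obtain ⟨Q, hQ, hYQ⟩ := hUreg Y hY.1.1
    obtain ⟨Q', hQ', hPQ', hYQ'⟩ := exists_mem_fatRegion hn hC hE hD hK hτ hτ1 hWQ hS hne hM hz hP
      hZ hZz hQ hYQ hY.2 (hY.1.2.trans_le (by gcongr; exact bdist_mono hΩ hUΩ hne hY.1.1))
    exact ⟨hY, mem_iUnion.2 ⟨⟨⟨Q', hQ'⟩, hPQ' hxP⟩, hYQ'⟩⟩
  have hUm : MeasurableSet (cone U z ∩ {Y | ε ≤ dist z Y}) := by
    have hUo : IsOpen U := isOpen_interior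
    have h1 : Continuous (bdist U) := Metric.continuous_infDist_pt _
    exact ((hUo.inter (isOpen_lt (by fun_prop) (by fun_prop) :
      IsOpen {Y | dist z Y < 10 * bdist U Y})).measurableSet).inter
      (isClosed_le (by fun_prop) (by fun_prop)).measurableSet
  calc _ ≤ ∫⁻ Y in cone U z ∩ {Y | ε ≤ dist z Y}, ENNReal.ofReal (30 ^ (n - 1)) * f Y := by
        refine setLIntegral_mono' hUm fun Y hY => ?_
        have h1 : bdist Ω Y ≤ 30 * bdist U Y := by
          have h2 := bdist_le_add Ω Y z
          rw [dist_comm] at h2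
          have h3 : ε ≤ dist z Y := hY.2
          have h4 := hY.1.2
          linarith
        have h0 : 0 < bdist Ω Y := by
          obtain ⟨Q, hQ, hYQ⟩ := hUreg Y hY.1.1
          have := Q.len_pos.trans_le (len_le_of_mem_region hK hWQ hne (hS.subset hQ) hYQ)
          exact (pos_iff_pos_of_mul_pos this).1 (by linarith)
        rw [mul_left_comm]
        gcongr
        exact ofReal_zpow_le h0 (by norm_num) h1 (Nat.one_le_iff_ne_zero.2 hn)
    _ = ENNReal.ofReal (30 ^ (n - 1)) * ∫⁻ Y in cone U z ∩ {Y | ε ≤ dist z Y}, f Y :=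
        lintegral_const_mul' _ _ ENNReal.ofReal_ne_top
    _ ≤ _ := by
        gcongr
        calc _ ≤ ∫⁻ Y in ⋃ Q : {Q : S // x ∈ Q.1.carrier}, fatRegion τ WQ DD M Q.1.1, f Y :=
              lintegral_mono_set fun Y hY => (hsub hY).2
          _ ≤ ∑' Q : {Q : S // x ∈ Q.1.carrier}, ∫⁻ Y in fatRegion τ WQ DD M Q.1.1, f Y :=
              lintegral_iUnion_le _ _
          _ = ∑' Q : {Q : S // x ∈ Q.1.carrier}, Q.1.1.carrier.indicator
                (fun _ => ∫⁻ Y in fatRegion τ WQ DD M Q.1.1, f Y) x :=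
              tsum_congr fun Q => (indicator_of_mem Q.2 (f := fun _ =>
                ∫⁻ Y in fatRegion τ WQ DD M Q.1.1, f Y)).symm
          _ ≤ ∑' Q : S, Q.1.carrier.indicator
                (fun _ => ∫⁻ Y in fatRegion τ WQ DD M Q.1, f Y) x :=
              ENNReal.tsum_comp_le_tsum_of_injective Subtype.val_injective
                (fun Q : S => Q.1.carrier.indicator
                  (fun _ => ∫⁻ Y in fatRegion τ WQ DD M Q.1, f Y) x)
          _ = treeSquare Ω τ WQ DD M S B x ^ 2 := by
              rw [treeSquare, ← ENNReal.rpow_natCast, ← ENNReal.rpow_mul]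
              norm_num
              rfl
          _ ≤ _ := by gcongr

end Far

/-! ### The part of the square function near the vertex -/

lemma lintegral_shell_le (hn : 1 ≤ n) (z : Pt n) {r : ℝ} (hr : 0 < r) :
    ∫⁻ Y in Metric.closedBall z r \ Metric.ball z (r / 2), ENNReal.ofReal (dist z Y ^ (1 - (n : ℤ))) ≤
      ENNReal.ofReal (2 ^ (n - 1) * r ^ 2) * volume (Metric.ball (0 : Pt n) 1) := by
  calc _ ≤ ∫⁻ _Y in Metric.closedBall z r \ Metric.ball z (r / 2),
          ENNReal.ofReal (2 ^ (n - 1)) * ENNReal.ofReal (r ^ (1 - (n : ℤ))) := by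
        refine setLIntegral_mono' (measurableSet_closedBall.diff measurableSet_ball) fun Y hY => ?_
        refine ofReal_zpow_le hr two_pos ?_ hn
        have := hY.2
        rw [Metric.mem_ball, not_lt, dist_comm] at this
        linarith
    _ ≤ ENNReal.ofReal (2 ^ (n - 1)) * ENNReal.ofReal (r ^ (1 - (n : ℤ))) *
          volume (Metric.closedBall z r) := by
        rw [setLIntegral_const]
        gcongr
        exact sdiff_subset
    _ = _ := by
        rw [Measure.addHaar_closedBall _ _ hr.le, finrank_euclideanSpace_fin, ← mul_assoc,
          ← ENNReal.ofReal_mul (by positivity), ← ENNReal.ofReal_mul (by positivity), mul_assoc]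
        congr 3
        rw [← zpow_natCast r (n + 1), ← zpow_add₀ hr.ne', ← zpow_natCast r 2]
        congr 1
        push_cast
        ring

/-- The constant in the bound of the integral of `|z - Y|^{1-n}` over a ball around `z`. -/
noncomputable def ballIntegralConst (n : ℕ) : ℝ :=
  2 ^ (n - 1) * (1 - (1 / 4 : ℝ))⁻¹ * (volume (Metric.ball (0 : Pt n) 1)).toReal

/-- Dyadic shells exhaust the punctured ball; the shell of radius `r 2⁻ʲ` contributes a multiple of
`r² 4⁻ʲ`. -/
lemma lintegral_ball_le (hn : 1 ≤ n) (z : Pt n) {r : ℝ} (hr : 0 < r) :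
    ∫⁻ Y in Metric.ball z r \ {z}, ENNReal.ofReal (dist z Y ^ (1 - (n : ℤ))) ≤
      ENNReal.ofReal (ballIntegralConst n * r ^ 2) := by
  have hsub : Metric.ball z r \ {z} ⊆
      ⋃ j : ℕ, Metric.closedBall z (r * (1 / 2) ^ j) \ Metric.ball z (r * (1 / 2) ^ j / 2) := by
    intro Y hY
    have hd : 0 < dist Y z := dist_pos.2 hY.2
    obtain ⟨j, hj, hj'⟩ := exists_nat_pow_near_of_lt_one (div_pos hd hr)
      ((div_le_one hr).2 (Metric.mem_ball.1 hY.1).le) (by norm_num : (0 : ℝ) < 1 / 2) (by norm_num)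
    rw [div_le_iff₀ hr] at hj'
    rw [lt_div_iff₀ hr, pow_succ] at hj
    refine mem_iUnion.2 ⟨j, ?_, ?_⟩
    · rw [Metric.mem_closedBall]
      linarith
    · rw [Metric.mem_ball, not_lt]
      linarith
  have hgeom := summable_geometric_of_lt_one (by norm_num : (0 : ℝ) ≤ 1 / 4) (by norm_num)
  calc _ ≤ ∑' j : ℕ, ∫⁻ Y in Metric.closedBall z (r * (1 / 2) ^ j) \
          Metric.ball z (r * (1 / 2) ^ j / 2), ENNReal.ofReal (dist z Y ^ (1 - (n : ℤ))) :=
        (lintegral_mono_set hsub).trans (lintegral_iUnion_le _ _)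
    _ ≤ ∑' j : ℕ, ENNReal.ofReal (2 ^ (n - 1) * r ^ 2 * (1 / 4) ^ j) *
          volume (Metric.ball (0 : Pt n) 1) := by
        refine ENNReal.tsum_le_tsum fun j =>
          (lintegral_shell_le hn z (by positivity)).trans_eq ?_
        congr 2
        rw [mul_pow, ← pow_mul, mul_comm j 2, pow_mul]
        norm_num
        ring
    _ = _ := by
        rw [ENNReal.tsum_mul_right, ← ENNReal.ofReal_tsum_of_nonneg (fun _ => by positivity)
          (hgeom.mul_left _), tsum_mul_left, tsum_geometric_of_lt_one (by norm_num) (by norm_num),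
          ← ENNReal.ofReal_toReal (measure_ball_lt_top (μ := volume) (x := (0 : Pt n))).ne,
          ← ENNReal.ofReal_mul (by norm_num; positivity), ballIntegralConst]
        congr 1
        ring

lemma lintegral_near_le (hn : 1 ≤ n) {Ω U : Set (Pt n)} (hU : IsOpen U) (B : Pt n → Pt n)
    {ε : ℝ} (hε : 0 < ε) {z : Pt n} (hz : bdist Ω z = 2 * ε) (hzU : z ∉ U) :
    ∫⁻ Y in cone U z ∩ {Y | dist z Y < ε},
        ‖B Y‖ₑ ^ 2 * ENNReal.ofReal (bdist U Y ^ (1 - (n : ℤ))) ≤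
      ENNReal.ofReal (10 ^ (n - 1) * ballIntegralConst n) *
        essSup (fun Y => ENNReal.ofReal (bdist Ω Y) * ‖B Y‖ₑ) (volume.restrict U) ^ 2 := by
  set T := essSup (fun Y => ENNReal.ofReal (bdist Ω Y) * ‖B Y‖ₑ) (volume.restrict U)
  set V := cone U z ∩ {Y | dist z Y < ε} with hV
  have hVm : MeasurableSet V := by
    have h1 : Continuous (bdist U) := Metric.continuous_infDist_pt _
    exact ((hU.inter (isOpen_lt (by fun_prop) (by fun_prop) :
      IsOpen {Y | dist z Y < 10 * bdist U Y})).inter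
      (isOpen_lt (by fun_prop) (by fun_prop))).measurableSet
  have hVsub : V ⊆ Metric.ball z ε \ {z} := fun Y hY =>
    ⟨by rw [Metric.mem_ball, dist_comm]; exact hY.2, fun h => hzU (h ▸ hY.1.1)⟩
  have hT : ∀ᵐ Y ∂volume.restrict V, ENNReal.ofReal (bdist Ω Y) * ‖B Y‖ₑ ≤ T :=
    ae_mono (Measure.restrict_mono (fun Y hY => hY.1.1) le_rfl)
      (ENNReal.ae_le_essSup (μ := volume.restrict U) _)
  have hε0 : ENNReal.ofReal ε ≠ 0 := (ENNReal.ofReal_pos.2 hε).ne'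
  have hm : Measurable fun Y : Pt n => ENNReal.ofReal (dist z Y ^ (1 - (n : ℤ))) := by fun_prop
  calc _ ≤ ∫⁻ Y in V, ENNReal.ofReal (10 ^ (n - 1)) * (T / ENNReal.ofReal ε) ^ 2 *
          ENNReal.ofReal (dist z Y ^ (1 - (n : ℤ))) := by
        refine lintegral_mono_ae ?_
        filter_upwards [hT, ae_restrict_mem hVm] with Y hYT hY
        -- `δ(Y) ≥ δ(z) - |z - Y| ≥ 2ε - ε`.
        have h1 : ε ≤ bdist Ω Y := by
          have h2 := bdist_le_add Ω z Y
          have h3 : dist z Y < ε := hY.2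
          linarith
        have h2 : ‖B Y‖ₑ ≤ T / ENNReal.ofReal ε := by
          rw [ENNReal.le_div_iff_mul_le (Or.inl hε0) (Or.inl ENNReal.ofReal_ne_top), mul_comm]
          refine le_trans ?_ hYT
          gcongr
        have h3 : 0 < dist z Y := dist_pos.2 fun h => hzU (h ▸ hY.1.1)
        rw [mul_comm (ENNReal.ofReal (10 ^ (n - 1))), mul_assoc]
        gcongr
        exact ofReal_zpow_le h3 (by norm_num) hY.1.2.le hn
    _ ≤ ENNReal.ofReal (10 ^ (n - 1)) * (T / ENNReal.ofReal ε) ^ 2 *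
          ENNReal.ofReal (ballIntegralConst n * ε ^ 2) := by
        rw [lintegral_const_mul _ hm]
        gcongr
        exact (lintegral_mono_set hVsub).trans (lintegral_ball_le hn z hε)
    _ = _ := by
        have h0 : 0 ≤ ballIntegralConst n := by unfold ballIntegralConst; norm_num
        rw [ENNReal.ofReal_mul h0, ENNReal.ofReal_mul (by positivity), ENNReal.ofReal_pow hε.le]
        have : (T / ENNReal.ofReal ε) ^ 2 * ENNReal.ofReal ε ^ 2 = T ^ 2 := by
          rw [← mul_pow, ENNReal.div_mul_cancel hε0 ENNReal.ofReal_ne_top]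
        rw [← this]
        ring

/-! ### Combination of the far and near parts -/

/-- As `z ∉ U`, the truncated cones increase to the full one. This serves vertices with `δ(z) = 0`,
where the far bound holds for every `ε` with the same constant. -/
lemma lintegral_cone_eq_iSup {U : Set (Pt n)} {z : Pt n} (hz : z ∉ U) (f : Pt n → ℝ≥0∞) :
    ∫⁻ Y in cone U z, f Y =
      ⨆ j : ℕ, ∫⁻ Y in cone U z ∩ {Y | 1 / ((j : ℝ) + 1) ≤ dist z Y}, f Y := by
  rw [← setLIntegral_iUnion_of_directed, ← inter_iUnion]
  · congr 2
    refine (inter_eq_left.2 fun Y hY => mem_iUnion.2 ?_).symm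
    obtain ⟨j, hj⟩ := exists_nat_one_div_lt (dist_pos.2 fun h => hz (h ▸ hY.1) : 0 < dist z Y)
    exact ⟨j, hj.le⟩
  · refine Monotone.directed_le fun i j hij => inter_subset_inter_right _ fun Y hY => ?_
    have hle : (i : ℝ) + 1 ≤ j + 1 := by gcongr
    exact (one_div_le_one_div_of_le (by positivity) hle).trans hY

/-- The constant in the bound of the conical square function of a sawtooth domain. -/
noncomputable def squareConst (n : ℕ) : ℝ := 1 + 30 ^ (n - 1) + 10 ^ (n - 1) * ballIntegralConst n

lemma ballIntegralConst_nonneg : 0 ≤ ballIntegralConst n := by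
  unfold ballIntegralConst
  norm_num

lemma one_le_squareConst : 1 ≤ squareConst n := by
  have := ballIntegralConst_nonneg (n := n)
  have : 0 ≤ (30 : ℝ) ^ (n - 1) + 10 ^ (n - 1) * ballIntegralConst n := by positivity
  unfold squareConst
  linarith

lemma rpow_half_le {a b t x y : ℝ≥0∞} (ha : a ≤ t) (hb : b ≤ t) (ht : 1 ≤ t) :
    (a * x ^ 2 + b * y ^ 2) ^ (1 / 2 : ℝ) ≤ t * (x + y) := by
  have h : a * x ^ 2 + b * y ^ 2 ≤ (t * (x + y)) ^ 2 := by
    calc a * x ^ 2 + b * y ^ 2 ≤ t * x ^ 2 + t * y ^ 2 := by gcongr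
      _ = t * (x ^ 2 + y ^ 2) := by ring
      _ ≤ t ^ 2 * (x + y) ^ 2 := by
          gcongr
          · exact le_self_pow₀ ht two_ne_zero
          · calc x ^ 2 + y ^ 2 ≤ x ^ 2 + y ^ 2 + 2 * x * y := le_self_add
              _ = _ := by ring
      _ = _ := by ring
  calc _ ≤ ((t * (x + y)) ^ 2) ^ (1 / 2 : ℝ) := by gcongr
    _ = _ := by
        rw [← ENNReal.rpow_natCast, ← ENNReal.rpow_mul]
        norm_num

lemma conicalSquare_le {K τ : ℝ} {Ω : Set (Pt n)} {W : Set (Box n)} {WQ : Cube n → Set (Box n)}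
    {g : GridConst} {D : ℤ → Set (Set (Pt n))} {S : Set (Cube n)} {Q₀ : Cube n} {C : ℝ}
    (hn : n ≠ 0) (hC : 1 ≤ C) (hΩ : IsOpen Ω) (hE : IsADR (frontier Ω) C)
    (hD : IsDyadicGrid g (frontier Ω) D) (hK : 1 ≤ K) (hτ : 0 < τ) (hτ1 : τ ≤ 1)
    (hW : IsWhitney Ω W) (hWQ : IsWhitneyChoice K τ Ω (cubes g (frontier Ω) D) W WQ)
    (hS : IsTree (cubes g (frontier Ω) D) Q₀ S)
    {M : ℝ} (hM : fatConst n K g C ≤ M) (B : Pt n → Pt n) {z : Pt n}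
    (hz : z ∈ frontier (sawtooth τ WQ S)) :
    conicalSquare (sawtooth τ WQ S) B z ≤ ENNReal.ofReal (squareConst n) *
      (essSup (treeSquare Ω τ WQ (cubes g (frontier Ω) D) M S B)
          ((surf Ω).restrict Q₀.carrier)
        + essSup (fun Y => ENNReal.ofReal (bdist Ω Y) * ‖B Y‖ₑ)
          (volume.restrict (sawtooth τ WQ S))) := by
  have hne : (frontier Ω).Nonempty := by
    obtain ⟨x, -, hx, -⟩ := exists_ball_subset hD (hS.subset hS.top_mem)
    exact ⟨x, hx⟩
  have hUo : IsOpen (sawtooth τ WQ S) := isOpen_interior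
  have hzU : z ∉ sawtooth τ WQ S := by
    rw [hUo.frontier_eq] at hz
    exact hz.2
  have hzc := frontier_subset_closure hz
  have hfar := fun (ε : ℝ) (hε : 0 < ε) (h : bdist Ω z ≤ 2 * ε) =>
    lintegral_far_le hn hC hΩ hE hD hK hτ hτ1 hW hWQ hS hne hM B hε h hzc
  set N := essSup (treeSquare Ω τ WQ (cubes g (frontier Ω) D) M S B)
    ((surf Ω).restrict Q₀.carrier)
  have hI0 := ballIntegralConst_nonneg (n := n)
  have h30 : (0 : ℝ) ≤ 30 ^ (n - 1) := by positivity
  have h10 : (0 : ℝ) ≤ 10 ^ (n - 1) * ballIntegralConst n := by positivity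
  refine le_trans (ENNReal.rpow_le_rpow ?_ (by norm_num)) (rpow_half_le
    (a := ENNReal.ofReal (30 ^ (n - 1)))
    (b := ENNReal.ofReal (10 ^ (n - 1) * ballIntegralConst n))
    (ENNReal.ofReal_le_ofReal (by unfold squareConst; linarith))
    (ENNReal.ofReal_le_ofReal (by unfold squareConst; linarith))
    (ENNReal.one_le_ofReal.2 one_le_squareConst))
  have hb : 0 ≤ bdist Ω z := Metric.infDist_nonneg
  -- For `δ(z) = 0` the far bound alone suffices; otherwise the split is at `ε = δ(z)/2`.
  rcases hb.eq_or_lt with h0 | h0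
  · refine le_add_right ?_
    rw [lintegral_cone_eq_iSup hzU]
    refine iSup_le fun j => hfar _ (by positivity) ?_
    rw [← h0]
    positivity
  · have hε := half_pos h0
    have hnear := lintegral_near_le (Nat.one_le_iff_ne_zero.2 hn) hUo B hε
      (by ring : bdist Ω z = 2 * (bdist Ω z / 2)) hzU
    refine (lintegral_mono_set fun Y hY => ?_).trans
      ((lintegral_union_le _ _ _).trans (add_le_add (hfar _ hε (by linarith)) hnear))
    rcases le_or_gt (bdist Ω z / 2) (dist z Y) with h | h
    · exact Or.inl ⟨hY, h⟩
    · exact Or.inr ⟨hY, h⟩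

end Sawtooth

theorem lemma5p2 (n : ℕ) (hn : 2 ≤ n) (c : CADConst) (g : GridConst) (K : ℝ) (hK : 1 ≤ K) :
    ∃ M₀ : ℝ, 2 ≤ M₀ ∧ ∃ C : ℝ, 0 < C ∧
      ∀ Ω : Set (Pt n), IsOneSidedCAD c Ω →
      ∀ D : ℤ → Set (Set (Pt n)), IsDyadicGrid g (frontier Ω) D →
      ∀ W : Set (Box n), IsWhitney Ω W →
      ∀ τ : ℝ, 0 < τ → τ ≤ 1 →
      ∀ WQ : Cube n → Set (Box n),
        IsWhitneyChoice K τ Ω (cubes g (frontier Ω) D) W WQ →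
      ∀ Q₀ ∈ cubes g (frontier Ω) D,
      ∀ S : Set (Cube n), IsTree (cubes g (frontier Ω) D) Q₀ S →
      ∀ B : Pt n → Pt n, AEMeasurable B (volume.restrict Ω) →
      ∀ M : ℝ, M₀ ≤ M →
        essSup (conicalSquare (sawtooth τ WQ S) B)
            ((hausN n).restrict (frontier (sawtooth τ WQ S)))
          ≤ ENNReal.ofReal C *
            (essSup (treeSquare Ω τ WQ (cubes g (frontier Ω) D) M S B)
                ((surf Ω).restrict Q₀.carrier)
              + essSup (fun Y => ENNReal.ofReal (bdist Ω Y) * ‖B Y‖ₑ)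
                (volume.restrict (sawtooth τ WQ S))) := by
  refine ⟨fatConst n K g c.adr, (le_max_left _ _).trans (le_max_left _ _), squareConst n,
    zero_lt_one.trans_le one_le_squareConst, ?_⟩
  intro Ω hΩ D hD W hW τ hτ hτ1 WQ hWQ Q₀ _ S hS B _ M hM
  refine essSup_le_of_ae_le _ ?_
  filter_upwards [ae_restrict_mem isClosed_frontier.measurableSet] with z hz
  exact conicalSquare_le (by omega) c.adr_ge hΩ.isOpen hΩ.adr hD hK hτ hτ1 hW hWQ hS hM B hz
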